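/- For a partition $\lambda$, let the hook number of a cell of its Young diagram be the number of cells weakly to its right in the same row or weakly below it in the same column (the cell itself counted once), and let $\mathcal H_t(\lambda)$ be the multiset of those hook numbers of $\lambda$ that are multiples of $t$. Put $$p_t(a,b;n) := \#\{\lambda \vdash n : \#\mathcal H_t(\lambda) \equiv a \pmod b\}.$$ Then the following are true. (1) If $\ell$ is an odd prime and $0\le a_1,a_2<\ell$ are integers satisfying $\left(\frac{-16a_1+8a_2+1}{\ell}\right)=-1$ (Legendre symbol), then $p_2(a_1,\ell;\ell n+a_2)=0$ for every non-negative integer $n$. (2) If $\ell\equiv 2\pmod 3$ is prime and $0\le a_1,a_2<\ell^2$ are integers satisfying $\operatorname{ord}_\ell(-9a_1+3a_2+1)=1$ (the exact power of $\ell$ dividing $-9a_1+3a_2+1$ is $\ell^1$), then $p_3(a_1,\ell^2;\ell^2 n+a_2)=0$ for every non-negative integer $n$. -/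

import Mathlib

/-- The Young diagram of a partition: its rows are the parts in weakly decreasing order. -/
def Nat.Partition.youngDiagram {n : ℕ} (lam : n.Partition) : YoungDiagram :=
  YoungDiagram.ofRowLens (lam.parts.sort (· ≥ ·)) (Multiset.pairwise_sort _ _).sortedGE

/-- The hook number of a cell `(i, j)` of `μ`: the cells of row `i` strictly to the right of it,
the cells of column `j` strictly below it, and the cell itself. -/
def YoungDiagram.hookNumber (μ : YoungDiagram) (c : ℕ × ℕ) : ℕ :=
  (μ.rowLen c.1 - (c.2 + 1)) + (μ.colLen c.2 - (c.1 + 1)) + 1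

/-- The multiset `ℋ(λ)` of hook numbers of the partition `λ`. -/
def Nat.Partition.hooks {n : ℕ} (lam : n.Partition) : Multiset ℕ :=
  lam.youngDiagram.cells.val.map lam.youngDiagram.hookNumber

/-- The multiset `ℋ_t(λ)` of hook numbers of `λ` that are multiples of `t`. -/
def Nat.Partition.tHooks {n : ℕ} (t : ℕ) (lam : n.Partition) : Multiset ℕ :=
  lam.hooks.filter (t ∣ ·)

/-- `p_t(a, b; n)`: the number of partitions `λ` of `n` with `#ℋ_t(λ) ≡ a (mod b)`. -/
def tHookPartitionCount (t a b n : ℕ) : ℕ :=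
  (Finset.univ.filter fun lam : n.Partition => (lam.tHooks t).card ≡ a [MOD b]).card

/-! ### Hook numbers read off from beta numbers. -/

namespace YoungDiagram

/-! If w hook numbers of a partition of n are multiples of t, then n - tw is the size of its t-core.
The core is never built: the hook numbers of row i are the differences β_i - v, with v < β_i not a
beta number, and counting them modulo t gives `two_mul_card_add`, which expresses n - tw by the
residue counts of the beta numbers. Hence 8(n - 2w) + 1 is a square, and 3(n - 3w) + 1 is a norm x²
+ xy + y². Modulo ℓ the first cannot be a nonresidue; a prime ℓ ≡ 2 (mod 3) dividing the second
divides x and y, so ℓ² divides it. -/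

/-- The first column hook lengths of `μ`: the row lengths shifted to be strictly decreasing. -/
def betaNumber (μ : YoungDiagram) (i : ℕ) : ℕ := μ.rowLen i + (μ.colLen 0 - 1 - i)

theorem lt_rowLen_iff_lt_colLen (μ : YoungDiagram) {i j : ℕ} :
    j < μ.rowLen i ↔ i < μ.colLen j := by
  rw [← mem_iff_lt_rowLen, mem_iff_lt_colLen]

theorem sum_cells_eq_sum_rows (μ : YoungDiagram) (f : ℕ × ℕ → ℕ) :
    ∑ c ∈ μ.cells, f c =
      ∑ i ∈ Finset.range (μ.colLen 0), ∑ j ∈ Finset.range (μ.rowLen i), f (i, j) := by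
  refine Finset.sum_finset_product _ _ _ fun p => ?_
  rw [Finset.mem_range, Finset.mem_range, mem_cells, ← lt_rowLen_iff_lt_colLen]
  rw [show p ∈ μ ↔ (p.1, p.2) ∈ μ from Iff.rfl, mem_iff_lt_rowLen]
  omega

theorem card_eq_sum_rowLen (μ : YoungDiagram) :
    μ.card = ∑ i ∈ Finset.range (μ.colLen 0), μ.rowLen i := by
  have h := μ.sum_cells_eq_sum_rows fun _ => 1
  simpa using h

theorem betaNumber_lt {μ : YoungDiagram} {i m : ℕ} (him : i < m) (hm : m < μ.colLen 0) :
    μ.betaNumber m < μ.betaNumber i := by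
  have := μ.rowLen_anti _ _ him.le
  unfold betaNumber
  omega

theorem betaNumber_injOn (μ : YoungDiagram) :
    Set.InjOn μ.betaNumber (Set.Iio (μ.colLen 0)) := by
  intro a ha b hb hab
  rcases lt_trichotomy a b with h | h | h
  · exact absurd hab (betaNumber_lt h hb).ne'
  · exact h
  · exact absurd hab (betaNumber_lt h ha).ne

/-- The numbers below `betaNumber i` are the differences of `betaNumber i` with the hook numbers of
row `i`, together with the later `betaNumber`s. -/
theorem sum_range_betaNumber {μ : YoungDiagram} {i : ℕ} (hi : i < μ.colLen 0) (g : ℕ → ℕ) :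
    ∑ v ∈ Finset.range (μ.betaNumber i), g v =
      ∑ j ∈ Finset.range (μ.rowLen i), g (μ.colLen 0 + j - μ.colLen j) +
        ∑ m ∈ Finset.Ioo i (μ.colLen 0), g (μ.betaNumber m) := by
  have hcol : ∀ j, μ.colLen j ≤ μ.colLen 0 := fun j => μ.colLen_anti _ _ j.zero_le
  have hmono : StrictMono fun j => μ.colLen 0 + j - μ.colLen j := by
    intro a b hab
    have := μ.colLen_anti _ _ hab.le
    have := hcol a
    have := hcol b
    simp only
    omega
  have hinj : Set.InjOn μ.betaNumber (Finset.Ioo i (μ.colLen 0)) :=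
    μ.betaNumber_injOn.mono fun m hm => (Finset.mem_Ioo.1 hm).2
  have hdisj : Disjoint
      ((Finset.range (μ.rowLen i)).image fun j => μ.colLen 0 + j - μ.colLen j)
      ((Finset.Ioo i (μ.colLen 0)).image μ.betaNumber) := by
    rw [Finset.disjoint_left]
    intro v hv hv'
    obtain ⟨j, -, rfl⟩ := Finset.mem_image.1 hv
    obtain ⟨m, hm, h⟩ := Finset.mem_image.1 hv'
    rw [Finset.mem_Ioo] at hm
    have := hcol j
    have := μ.lt_rowLen_iff_lt_colLen (i := m) (j := j)
    unfold betaNumber at h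
    omega
  have hrange : (Finset.range (μ.rowLen i)).image (fun j => μ.colLen 0 + j - μ.colLen j) ∪
      (Finset.Ioo i (μ.colLen 0)).image μ.betaNumber = Finset.range (μ.betaNumber i) := by
    -- Inclusion suffices: the two disjoint images have `rowLen i` and `colLen 0 - 1 - i` elements,
    -- in total `betaNumber i`.
    apply Finset.eq_of_subset_of_card_le
    · intro v hv
      rw [Finset.mem_range]
      rcases Finset.mem_union.1 hv with hv | hv
      · obtain ⟨j, hj, rfl⟩ := Finset.mem_image.1 hv
        rw [Finset.mem_range] at hj
        have := μ.lt_rowLen_iff_lt_colLen.1 hj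
        have := hcol j
        unfold betaNumber
        omega
      · obtain ⟨m, hm, rfl⟩ := Finset.mem_image.1 hv
        rw [Finset.mem_Ioo] at hm
        exact betaNumber_lt hm.1 hm.2
    · rw [Finset.card_union_of_disjoint hdisj, Finset.card_image_of_injOn hmono.injective.injOn,
        Finset.card_image_of_injOn hinj]
      simp only [Finset.card_range, Nat.card_Ioo, betaNumber]
      omega
  rw [← hrange, Finset.sum_union hdisj, Finset.sum_image hmono.injective.injOn,
    Finset.sum_image hinj]

/-- Both terms count v < β_i with v ≡ β_i modulo t; there are ⌊β_i / t⌋ of these. -/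
theorem card_row_filter_dvd_hookNumber {μ : YoungDiagram} {i t : ℕ} (ht : 0 < t)
    (hi : i < μ.colLen 0) :
    ((Finset.range (μ.rowLen i)).filter fun j => t ∣ μ.hookNumber (i, j)).card +
      ((Finset.Ioo i (μ.colLen 0)).filter
        fun m => μ.betaNumber m % t = μ.betaNumber i % t).card = μ.betaNumber i / t := by
  have hcount : ((Finset.range (μ.betaNumber i)).filter
      fun v => v % t = μ.betaNumber i % t).card = μ.betaNumber i / t := by
    rw [← Nat.count_eq_card_filter_range]
    have h := Nat.count_modEq_card (μ.betaNumber i) ht (μ.betaNumber i)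
    rw [if_neg (lt_irrefl _), add_zero] at h
    rw [← h]
    unfold Nat.ModEq
    congr!
  rw [← hcount]
  simp only [Finset.card_filter]
  rw [sum_range_betaNumber hi]
  congr 1
  refine Finset.sum_congr rfl fun j hj => ?_
  have hj := Finset.mem_range.1 hj
  have h1 := μ.lt_rowLen_iff_lt_colLen.1 hj
  have h2 := μ.colLen_anti _ _ j.zero_le
  have h3 : μ.betaNumber i = (μ.colLen 0 + j - μ.colLen j) + μ.hookNumber (i, j) := by
    simp only [betaNumber, hookNumber]
    omega
  refine if_congr ?_ rfl rfl
  have h4 := Nat.modEq_iff_dvd' (n := t) (Nat.le.intro h3.symm)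
  rw [h3, Nat.add_sub_cancel_left] at h4
  rw [h3]
  exact h4.symm

theorem card_filter_dvd_hookNumber (μ : YoungDiagram) {t : ℕ} (ht : 0 < t) :
    (μ.cells.filter fun c => t ∣ μ.hookNumber c).card +
      ∑ i ∈ Finset.range (μ.colLen 0), ((Finset.Ioo i (μ.colLen 0)).filter
        fun m => μ.betaNumber m % t = μ.betaNumber i % t).card =
      ∑ i ∈ Finset.range (μ.colLen 0), μ.betaNumber i / t := by
  rw [Finset.card_filter, sum_cells_eq_sum_rows, ← Finset.sum_add_distrib]
  refine Finset.sum_congr rfl fun i hi => ?_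
  rw [← card_row_filter_dvd_hookNumber ht (Finset.mem_range.1 hi), ← Finset.card_filter]

theorem two_mul_sum_betaNumber (μ : YoungDiagram) :
    2 * ∑ i ∈ Finset.range (μ.colLen 0), μ.betaNumber i + μ.colLen 0 =
      2 * μ.card + μ.colLen 0 ^ 2 := by
  unfold betaNumber
  have hrefl := Finset.sum_range_reflect id (μ.colLen 0)
  simp only [id] at hrefl
  rw [Finset.sum_add_distrib, ← card_eq_sum_rowLen, hrefl]
  have h := Finset.sum_range_id_mul_two (μ.colLen 0)
  rcases Nat.eq_zero_or_pos (μ.colLen 0) with h0 | h0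
  · simp [h0]
  · obtain ⟨k, hk⟩ := Nat.exists_eq_add_of_lt h0
    rw [hk] at h ⊢
    simp only [Nat.add_sub_cancel] at h
    nlinarith

end YoungDiagram

/-- Both sides count ordered pairs of indices with equal values: off the diagonal and on it, or
value by value. -/
theorem two_mul_sum_card_filter_Ioo_add (f : ℕ → ℕ) {t : ℕ} (hf : ∀ i, f i < t) (k : ℕ) :
    2 * ∑ i ∈ Finset.range k, ((Finset.Ioo i k).filter fun m => f m = f i).card + k =
      ∑ r ∈ Finset.range t, ((Finset.range k).filter fun i => f i = r).card ^ 2 := by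
  induction k with
  | zero => simp
  | succ k ih =>
    have hl : ∑ i ∈ Finset.range (k + 1), ((Finset.Ioo i (k + 1)).filter fun m => f m = f i).card =
        ∑ i ∈ Finset.range k, ((Finset.Ioo i k).filter fun m => f m = f i).card +
          ((Finset.range k).filter fun i => f i = f k).card := by
      rw [Finset.sum_range_succ]
      simp only [Finset.card_filter]
      rw [← Finset.sum_add_distrib]
      have h0 : Finset.Ioo k (k + 1) = ∅ := by
        ext m
        simp only [Finset.mem_Ioo, Finset.notMem_empty, iff_false]
        omega
      rw [h0, Finset.sum_empty, add_zero]
      refine Finset.sum_congr rfl fun i hi => ?_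
      have hi := Finset.mem_range.1 hi
      have h1 : Finset.Ioo i (k + 1) = insert k (Finset.Ioo i k) := by
        ext m
        simp only [Finset.mem_Ioo, Finset.mem_insert]
        omega
      rw [h1, Finset.sum_insert (by simp), add_comm]
      simp only [eq_comm]
    have hr : ∀ r ∈ Finset.range t, ((Finset.range (k + 1)).filter fun i => f i = r).card ^ 2 =
        ((Finset.range k).filter fun i => f i = r).card ^ 2 +
          if f k = r then 2 * ((Finset.range k).filter fun i => f i = r).card + 1 else 0 := by
      intro r _
      simp only [Finset.card_filter, Finset.sum_range_succ]
      split_ifs <;> ring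
    rw [hl, Finset.sum_congr rfl hr, Finset.sum_add_distrib, Finset.sum_ite_eq,
      if_pos (Finset.mem_range.2 (hf k)), ← ih]
    ring

/-! ### Core size as a quadratic form in the residue counts. -/

namespace YoungDiagram

/-- The number of `betaNumber`s of `μ` that are congruent to `r` modulo `t`. -/
def residueCount (μ : YoungDiagram) (t r : ℕ) : ℕ :=
  ((Finset.range (μ.colLen 0)).filter fun i => μ.betaNumber i % t = r).card

theorem sum_residueCount_mul (μ : YoungDiagram) {t : ℕ} (ht : 0 < t) (g : ℕ → ℕ) :
    ∑ r ∈ Finset.range t, μ.residueCount t r * g r =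
      ∑ i ∈ Finset.range (μ.colLen 0), g (μ.betaNumber i % t) := by
  have hmaps : ∀ i ∈ Finset.range (μ.colLen 0), μ.betaNumber i % t ∈ Finset.range t :=
    fun i _ => Finset.mem_range.2 (Nat.mod_lt _ ht)
  rw [← Finset.sum_fiberwise_of_maps_to hmaps fun i => g (μ.betaNumber i % t)]
  refine Finset.sum_congr rfl fun r _ => ?_
  have hconst : ∀ i ∈ (Finset.range (μ.colLen 0)).filter fun i => μ.betaNumber i % t = r,
      g (μ.betaNumber i % t) = g r := fun i hi => by rw [(Finset.mem_filter.1 hi).2]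
  rw [Finset.sum_congr rfl hconst, Finset.sum_const, smul_eq_mul, residueCount]

/-- The size of the `t`-core of `μ` in terms of the residue counts. -/
theorem two_mul_card_add (μ : YoungDiagram) {t : ℕ} (ht : 0 < t) :
    2 * μ.card + (∑ r ∈ Finset.range t, μ.residueCount t r) ^ 2 +
        t * ∑ r ∈ Finset.range t, μ.residueCount t r =
      2 * t * (μ.cells.filter fun c => t ∣ μ.hookNumber c).card +
        2 * ∑ r ∈ Finset.range t, μ.residueCount t r * r +
        t * ∑ r ∈ Finset.range t, μ.residueCount t r ^ 2 +
        ∑ r ∈ Finset.range t, μ.residueCount t r := by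
  have hk := μ.sum_residueCount_mul ht fun _ => 1
  simp only [mul_one, Finset.sum_const, Finset.card_range, smul_eq_mul] at hk
  have hs := μ.sum_residueCount_mul ht fun r => r
  have hpairs := two_mul_sum_card_filter_Ioo_add (fun i => μ.betaNumber i % t)
    (fun i => Nat.mod_lt _ ht) (μ.colLen 0)
  have hhooks := μ.card_filter_dvd_hookNumber ht
  have hbeta := μ.two_mul_sum_betaNumber
  have hdiv : ∑ i ∈ Finset.range (μ.colLen 0), μ.betaNumber i =
      t * ∑ i ∈ Finset.range (μ.colLen 0), μ.betaNumber i / t +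
        ∑ i ∈ Finset.range (μ.colLen 0), μ.betaNumber i % t := by
    rw [Finset.mul_sum, ← Finset.sum_add_distrib]
    exact Finset.sum_congr rfl fun i _ => (Nat.div_add_mod _ _).symm
  change _ = ∑ r ∈ Finset.range t, μ.residueCount t r ^ 2 at hpairs
  rw [hk, hs, ← hpairs]
  rw [hdiv, ← hhooks] at hbeta
  linarith

theorem exists_sq_eq_eight_mul_core (μ : YoungDiagram) :
    ∃ x : ℤ, 8 * ((μ.card : ℤ) - 2 * (μ.cells.filter fun c => 2 ∣ μ.hookNumber c).card) + 1 =
      x ^ 2 := by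
  have h := μ.two_mul_card_add Nat.two_pos
  simp_rw [Finset.sum_range_succ, Finset.sum_range_zero] at h
  generalize (μ.cells.filter fun c => 2 ∣ μ.hookNumber c).card = w at h ⊢
  zify at h
  -- With d = c₁ - c₀, `h` says 2(n - 2w) = d² + d; complete the square.
  refine ⟨2 * (μ.residueCount 2 1 - μ.residueCount 2 0) + 1, ?_⟩
  linear_combination 4 * h

theorem exists_norm_eq_three_mul_core (μ : YoungDiagram) :
    ∃ x y : ℤ, 3 * ((μ.card : ℤ) - 3 * (μ.cells.filter fun c => 3 ∣ μ.hookNumber c).card) + 1 =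
      x ^ 2 + x * y + y ^ 2 := by
  have h := μ.two_mul_card_add (t := 3) (by norm_num)
  simp_rw [Finset.sum_range_succ, Finset.sum_range_zero] at h
  generalize (μ.cells.filter fun c => 3 ∣ μ.hookNumber c).card = w at h ⊢
  zify at h
  -- For A = 2c₂ - c₁ - c₀ and B = 2c₁ - c₀ - c₂, the norm of (A, B) is the quadratic part;
  -- replacing A by A + 1 adds 2A + B + 1 = 3(c₂ - c₀) + 1.
  refine ⟨2 * μ.residueCount 3 2 - μ.residueCount 3 1 - μ.residueCount 3 0 + 1,
    2 * μ.residueCount 3 1 - μ.residueCount 3 0 - μ.residueCount 3 2, ?_⟩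
  have h' : 2 * (3 * ((μ.card : ℤ) - 3 * w) + 1) =
      2 * (3 * ((μ.residueCount 3 0 : ℤ) ^ 2 + μ.residueCount 3 1 ^ 2 + μ.residueCount 3 2 ^ 2
        - μ.residueCount 3 0 * μ.residueCount 3 1 - μ.residueCount 3 0 * μ.residueCount 3 2
        - μ.residueCount 3 1 * μ.residueCount 3 2)
        + 3 * (μ.residueCount 3 2 - μ.residueCount 3 0) + 1) := by
    linear_combination 3 * h
  have h'' := mul_left_cancel₀ two_ne_zero h'
  rw [h'']
  ring

theorem card_ofRowLens {w : List ℕ} (hw : w.SortedGE) (hpos : ∀ x ∈ w, 0 < x) :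
    (ofRowLens w hw).card = w.sum := by
  rw [card_eq_sum_rowLen]
  have h := rowLens_ofRowLens_eq_self (hw := hw) hpos
  conv_rhs => rw [← h]
  rw [rowLens, ← List.sum_toFinset _ List.nodup_range, List.toFinset_range]

end YoungDiagram

/-! ### Partitions, and the arithmetic of squares and norms. -/

namespace Nat.Partition

theorem card_youngDiagram {n : ℕ} (lam : n.Partition) : lam.youngDiagram.card = n := by
  have h : lam.youngDiagram.card = (lam.parts.sort (· ≥ ·)).sum :=
    YoungDiagram.card_ofRowLens _ fun x hx => lam.parts_pos ((Multiset.mem_sort _).1 hx)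
  rw [h, ← Multiset.sum_coe, Multiset.sort_eq, lam.parts_sum]

theorem card_tHooks {n : ℕ} (t : ℕ) (lam : n.Partition) :
    (lam.tHooks t).card =
      (lam.youngDiagram.cells.filter fun c => t ∣ lam.youngDiagram.hookNumber c).card := by
  rw [tHooks, hooks, Multiset.filter_map, Multiset.card_map]
  rfl

end Nat.Partition

theorem tHookPartitionCount_eq_zero {t a b n : ℕ}
    (h : ∀ lam : n.Partition, ¬ (lam.tHooks t).card ≡ a [MOD b]) :
    tHookPartitionCount t a b n = 0 := by
  rw [tHookPartitionCount, Finset.card_eq_zero, Finset.filter_eq_empty_iff]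
  exact fun lam _ => h lam

/-- A prime `ℓ ≡ 2 (mod 3)` is inert in the Eisenstein integers. -/
theorem Nat.Prime.dvd_of_dvd_norm {ℓ : ℕ} (hℓ : ℓ.Prime) (h3 : ℓ ≡ 2 [MOD 3]) {x y : ℤ}
    (h : (ℓ : ℤ) ∣ x ^ 2 + x * y + y ^ 2) : (ℓ : ℤ) ∣ x ∧ (ℓ : ℤ) ∣ y := by
  have : Fact ℓ.Prime := ⟨hℓ⟩
  have hcube : (x : ZMod ℓ) ^ 3 = (y : ZMod ℓ) ^ 3 := by
    have h0 := (ZMod.intCast_zmod_eq_zero_iff_dvd _ ℓ).2 h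
    push_cast at h0
    linear_combination (x - y : ZMod ℓ) * h0
  obtain ⟨k, hk⟩ : ∃ k, ℓ = 3 * k + 2 :=
    ⟨ℓ / 3, by have : ℓ % 3 = 2 := h3; omega⟩
  have hpowk : ∀ a : ZMod ℓ, a ^ ℓ = a ^ (3 * k + 2) := fun a => congrArg (a ^ ·) hk
  -- Cubing is injective modulo ℓ: 3(2k + 1) = ℓ + (3k + 1), so Fermat applied twice inverts it.
  have hpow : ∀ a : ZMod ℓ, (a ^ 3) ^ (2 * k + 1) = a := fun a => by
    calc (a ^ 3) ^ (2 * k + 1) = a ^ ℓ * a ^ (3 * k + 1) := by rw [hpowk]; ring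
      _ = a * a ^ (3 * k + 1) := by rw [ZMod.pow_card]
      _ = a ^ ℓ := by rw [hpowk]; ring
      _ = a := ZMod.pow_card a
  have hxy : (x : ZMod ℓ) = y := by rw [← hpow x, hcube, hpow]
  have h0 := (ZMod.intCast_zmod_eq_zero_iff_dvd _ ℓ).2 h
  push_cast at h0
  have hthree : (3 : ZMod ℓ) ≠ 0 := fun h3 => by
    have hdvd := (ZMod.natCast_eq_zero_iff 3 ℓ).1 (by exact_mod_cast h3)
    have := (Nat.prime_dvd_prime_iff_eq hℓ Nat.prime_three).1 hdvd
    omega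
  have hx : (x : ZMod ℓ) = 0 := by
    rw [← hxy] at h0
    have : (3 : ZMod ℓ) * (x : ZMod ℓ) ^ 2 = 0 := by linear_combination h0
    exact (_root_.pow_eq_zero_iff two_ne_zero).1 ((_root_.mul_eq_zero.1 this).resolve_left hthree)
  exact ⟨(ZMod.intCast_zmod_eq_zero_iff_dvd _ _).1 hx,
    (ZMod.intCast_zmod_eq_zero_iff_dvd _ _).1 (hxy ▸ hx)⟩

theorem legendreSym_sq_ne_neg_one {ℓ : ℕ} [Fact ℓ.Prime] (x : ℤ) : legendreSym ℓ (x ^ 2) ≠ -1 := by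
  rw [Ne, legendreSym.eq_neg_one_iff]
  simp [IsSquare.sq]

theorem theoremC6 :
    (∀ (ℓ : ℕ) [Fact ℓ.Prime], Odd ℓ → ∀ a₁ a₂ : ℕ, a₁ < ℓ → a₂ < ℓ →
      legendreSym ℓ (-16 * (a₁ : ℤ) + 8 * (a₂ : ℤ) + 1) = -1 →
        ∀ n : ℕ, tHookPartitionCount 2 a₁ ℓ (ℓ * n + a₂) = 0) ∧
    (∀ ℓ : ℕ, ℓ.Prime → ℓ ≡ 2 [MOD 3] → ∀ a₁ a₂ : ℕ, a₁ < ℓ ^ 2 → a₂ < ℓ ^ 2 →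
      padicValInt ℓ (-9 * (a₁ : ℤ) + 3 * (a₂ : ℤ) + 1) = 1 →
        ∀ n : ℕ, tHookPartitionCount 3 a₁ (ℓ ^ 2) (ℓ ^ 2 * n + a₂) = 0) := by
  refine ⟨fun ℓ _ _ a₁ a₂ _ _ hleg n => tHookPartitionCount_eq_zero fun lam hlam => ?_,
    fun ℓ hℓ h3 a₁ a₂ _ _ hord n => tHookPartitionCount_eq_zero fun lam hlam => ?_⟩
  · obtain ⟨x, hx⟩ := lam.youngDiagram.exists_sq_eq_eight_mul_core
    rw [lam.card_youngDiagram, ← lam.card_tHooks] at hx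
    refine legendreSym_sq_ne_neg_one (ℓ := ℓ) x ?_
    rw [← hleg, ← hx, legendreSym.mod, legendreSym.mod ℓ (-16 * (a₁ : ℤ) + 8 * (a₂ : ℤ) + 1)]
    congr 1
    obtain ⟨d, hd⟩ := (Nat.modEq_iff_dvd.1 hlam)
    refine Int.modEq_iff_dvd.2 ⟨-16 * d - 8 * n, ?_⟩
    push_cast
    linear_combination (-16 : ℤ) * hd
  · obtain ⟨x, y, hxy⟩ := lam.youngDiagram.exists_norm_eq_three_mul_core
    rw [lam.card_youngDiagram, ← lam.card_tHooks] at hxy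
    obtain ⟨d, hd⟩ := (Nat.modEq_iff_dvd.1 hlam)
    have : Fact ℓ.Prime := ⟨hℓ⟩
    have hz : -9 * (a₁ : ℤ) + 3 * (a₂ : ℤ) + 1 =
        x ^ 2 + x * y + y ^ 2 + (ℓ : ℤ) ^ 2 * (-9 * d - 3 * n) := by
      rw [← hxy]
      push_cast at hd ⊢
      linear_combination (-9 : ℤ) * hd
    -- It is 1 modulo 3; this excludes the zero case of `padicValInt_dvd_iff`.
    have hne : -9 * (a₁ : ℤ) + 3 * (a₂ : ℤ) + 1 ≠ 0 := by
      omega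
    have h1 : (ℓ : ℤ) ∣ -9 * (a₁ : ℤ) + 3 * (a₂ : ℤ) + 1 := by
      have := (padicValInt_dvd_iff 1 (-9 * (a₁ : ℤ) + 3 * (a₂ : ℤ) + 1) (p := ℓ)).2
        (Or.inr hord.ge)
      rwa [pow_one] at this
    have hnorm : (ℓ : ℤ) ∣ x ^ 2 + x * y + y ^ 2 := by
      rw [hz] at h1
      exact (dvd_add_left (Dvd.dvd.mul_right (dvd_pow_self _ two_ne_zero) _)).1 h1
    obtain ⟨⟨u, rfl⟩, ⟨v, rfl⟩⟩ := hℓ.dvd_of_dvd_norm h3 hnorm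
    have h2 : (ℓ : ℤ) ^ 2 ∣ -9 * (a₁ : ℤ) + 3 * (a₂ : ℤ) + 1 :=
      ⟨u ^ 2 + u * v + v ^ 2 + (-9 * d - 3 * n), by rw [hz]; ring⟩
    rcases (padicValInt_dvd_iff 2 _).1 h2 with h0 | h0
    · exact hne h0
    · omega
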